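/- A poset $\mathcal P=(X,\le)$ is an interval order if each $x\in X$ can be assigned a nonempty open interval $(l_x,r_x)$ of the real line such that, for all distinct $x,y\in X$, $x\le y$ if and only if $r_x\le l_y$. An interval order extension of a poset $(X,\le)$ is an interval order on $X$ whose order relation contains $\le$. The interval dimension $\operatorname{idim}(\mathcal P)$ of a poset $\mathcal P$ is the smallest positive integer $k$ such that the order relation of $\mathcal P$ is the intersection of $k$ interval order extensions of $\mathcal P$. There is a polynomial-time $O\!\left(\frac{n\sqrt{\log\log n}}{\sqrt{\log n}}\right)$-factor approximation algorithm for computing the interval dimension of any poset on $n$ elements. That is, there are a function $\alpha:\mathbb N\to\mathbb R$ with $\alpha(n)=O\!\left(\frac{n\sqrt{\log\log n}}{\sqrt{\log n}}\right)$ as $n\to\infty$, a polynomial $T$, and an algorithm (a program of a unit-cost random access machine with addition and truncated subtraction) which, given $n\ge 1$ and the $n\times n$ zero-one matrix of the order relation of any poset $\mathcal P$ on $n$ elements (listed in an arbitrary order), halts after at most $T(n)$ steps with a natural number $d$ such that $$\operatorname{idim}(\mathcal P)\le d\le \alpha(n)\cdot\operatorname{idim}(\mathcal P).$$ -/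

import Mathlib

/-! ### Interval orders and interval dimension -/

/-- A partial order `r` on `X` is an interval order if its elements can be assigned nonempty open
intervals `(l x, u x)` of the real line such that, for distinct `x` and `y`, `x` is below `y` if and
only if the interval of `x` lies to the left of that of `y`. -/
def IsIntervalOrder {X : Type*} (r : X → X → Prop) : Prop :=
  IsPartialOrder X r ∧
    ∃ l u : X → ℝ, (∀ x, l x < u x) ∧ ∀ x y, x ≠ y → (r x y ↔ u x ≤ l y)

/-- `r` is the intersection of `k` interval orders, each of which extends `r`. -/
def HasIntervalRealizer {X : Type*} (r : X → X → Prop) (k : ℕ) : Prop :=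
  ∃ Q : Fin k → X → X → Prop,
    (∀ i, IsIntervalOrder (Q i)) ∧ (∀ i x y, r x y → Q i x y) ∧
      ∀ x y, r x y ↔ ∀ i, Q i x y

/-- The interval dimension of a poset: the least positive `k` such that the order is the
intersection of `k` interval order extensions. -/
noncomputable def intervalDim (X : Type*) [PartialOrder X] : ℕ :=
  sInf {k : ℕ | 0 < k ∧ HasIntervalRealizer (fun x y : X => x ≤ y) k}

/-- If `a` is not below `b`, some interval order extension does not put `a` below `b`. -/
theorem exists_intervalOrder_not_le {X : Type*} [PartialOrder X] [Finite X] {a b : X}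
    (hab : ¬ a ≤ b) :
    ∃ r : X → X → Prop, IsIntervalOrder r ∧ (∀ x y, x ≤ y → r x y) ∧ ¬ r a b := by
  classical
  have := Fintype.ofFinite X
  let c : X → ℝ := fun x => ((Finset.univ.filter (fun z => z ≤ x)).card : ℝ)
  let g : X → ℝ := fun x => c x + if a ≤ x then (Fintype.card X : ℝ) else 0
  have hc : ∀ x y, x < y → c x + 1 ≤ c y := by
    intro x y h
    have : (Finset.univ.filter (fun z => z ≤ x)) ⊂ (Finset.univ.filter (fun z => z ≤ y)) := by
      refine Finset.ssubset_iff_of_subset ?_ |>.2 ⟨y, by simp, by simpa using h.not_ge⟩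
      intro z hz
      simp only [Finset.mem_filter, Finset.mem_univ, true_and] at hz ⊢
      exact hz.trans h.le
    have := Finset.card_lt_card this
    simp only [c]
    exact_mod_cast this
  have hg : ∀ x y, x < y → g x + 1 ≤ g y := by
    intro x y h
    have h1 := hc x y h
    simp only [g]
    by_cases hx : a ≤ x
    · simp only [hx, hx.trans h.le, if_true]; linarith
    · by_cases hy : a ≤ y
      · simp only [hx, hy, if_true, if_false]
        have : (0 : ℝ) ≤ Fintype.card X := Nat.cast_nonneg _
        linarith
      · simp only [hx, hy, if_false]; linarith
  refine ⟨fun x y => x = y ∨ g x ≤ g y - 1, ⟨?_, fun x => g x - 1, g, fun x => by linarith, ?_⟩,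
    ?_, ?_⟩
  · exact
      { refl := fun x => Or.inl rfl
        trans := by
          rintro x y z (rfl | h1) (rfl | h2)
          · exact Or.inl rfl
          · exact Or.inr h2
          · exact Or.inr h1
          · exact Or.inr (by linarith)
        antisymm := by
          rintro x y (h1 | h1) (h2 | h2)
          · exact h1
          · exact h1
          · exact h2.symm
          · linarith }
  · intro x y hxy
    simp [hxy]
  · intro x y h
    rcases h.eq_or_lt with h | h
    · exact Or.inl h
    · exact Or.inr (by linarith [hg x y h])
  · rintro (h | h)
    · exact hab h.le
    · have h1 : c b ≤ Fintype.card X := by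
        simp only [c]; exact_mod_cast Finset.card_le_univ _
      have h2 : 0 ≤ c a := Nat.cast_nonneg _
      simp only [g, hab, le_refl, if_true, if_false] at h
      linarith

/-- For a finite poset the minimum that defines the interval dimension is attained. -/
theorem intervalDim_spec (X : Type*) [PartialOrder X] [Finite X] :
    0 < intervalDim X ∧ HasIntervalRealizer (fun x y : X => x ≤ y) (intervalDim X) := by
  classical
  refine Nat.sInf_mem (s := {k : ℕ | 0 < k ∧ HasIntervalRealizer (fun x y : X => x ≤ y) k}) ?_
  by_cases hne : ∃ a b : X, ¬ a ≤ b
  · let S := {p : X × X // ¬ p.1 ≤ p.2}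
    obtain ⟨a, b, hab⟩ := hne
    have hS : Nonempty S := ⟨⟨(a, b), hab⟩⟩
    choose Q h1 h2 h3 using fun p : S => exists_intervalOrder_not_le p.2
    let e := Finite.equivFin S
    refine ⟨Nat.card S, Nat.card_pos, fun i => Q (e.symm i), fun i => h1 _, fun i => h2 _, ?_⟩
    intro x y
    refine ⟨fun h i => h2 _ _ _ h, fun h => ?_⟩
    by_contra hxy
    have : Q (e.symm (e ⟨(x, y), hxy⟩)) x y := h (e ⟨(x, y), hxy⟩)
    rw [Equiv.symm_apply_apply] at this
    exact h3 ⟨(x, y), hxy⟩ this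
  · push Not at hne
    have hsub : ∀ x y : X, x = y := fun x y => le_antisymm (hne x y) (hne y x)
    refine ⟨1, Nat.one_pos, fun _ x y => x ≤ y, fun _ => ⟨inferInstance, fun _ => 0, fun _ => 1,
      fun _ => one_pos, fun x y hxy => (hxy (hsub x y)).elim⟩, fun _ _ _ h => h, ?_⟩
    intro x y
    exact ⟨fun h _ => h, fun h => h 0⟩

/-! ### A random access machine with step count

Programs of a unit-cost random access machine, with structured control flow. The memory consists of
scalar variables and arrays, each named by a number that is fixed in the program text, so that a
program uses only finitely many of them; array cells are addressed by computed indices. All cells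
hold natural numbers. The only arithmetic operations are addition and truncated subtraction, so
that in `t` steps only numbers of `O(t)` more bits than those of the input and of the program
text can be produced, and running times agree with those of Turing machines up to a polynomial. -/

namespace RAM

/-- The contents of the memory. -/
structure Store where
  /-- the values of the scalar variables -/
  var : ℕ → ℕ
  /-- `arr a i` is the cell with index `i` of the array `a` -/
  arr : ℕ → ℕ → ℕ

/-- Arithmetic terms. -/
inductive AExp where
  /-- a literal -/
  | const (c : ℕ)
  /-- the value of a variable -/
  | var (x : ℕ)
  /-- `get a e` reads the cell of the array `a` whose index is the value of `e` -/
  | get (a : ℕ) (e : AExp)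
  /-- addition -/
  | add (e f : AExp)
  /-- truncated subtraction -/
  | sub (e f : AExp)

/-- The value of a term. -/
def AExp.val (s : Store) : AExp → ℕ
  | const c => c
  | var x => s.var x
  | get a e => s.arr a (e.val s)
  | add e f => e.val s + f.val s
  | sub e f => e.val s - f.val s

/-- The number of steps for evaluating a term: one for each operation and each operand in it. -/
def AExp.cost : AExp → ℕ
  | const _ => 1
  | var _ => 1
  | get _ e => e.cost + 1
  | add e f => e.cost + f.cost + 1
  | sub e f => e.cost + f.cost + 1

/-- Programs. -/
inductive Prog where
  /-- do nothing -/
  | skip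
  /-- `assign x e` sets the variable `x` to the value of `e` -/
  | assign (x : ℕ) (e : AExp)
  /-- `put a e f` sets the cell of the array `a` whose index is the value of `e` to the value
  of `f` -/
  | put (a : ℕ) (e f : AExp)
  /-- run `p`, then `q` -/
  | seq (p q : Prog)
  /-- run `p` if the value of `e` is not zero, and `q` otherwise -/
  | cond (e : AExp) (p q : Prog)
  /-- run `p` again and again as long as the value of `e` is not zero -/
  | loop (e : AExp) (p : Prog)

/-- The store after an assignment to a variable. -/
def Store.setVar (s : Store) (x v : ℕ) : Store :=
  { s with var := Function.update s.var x v }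

/-- The store after an assignment to an array cell. -/
def Store.setArr (s : Store) (a i v : ℕ) : Store :=
  { s with arr := Function.update s.arr a (Function.update (s.arr a) i v) }

/-- `Exec p s t s'`: the program `p`, started with the store `s`, halts after exactly `t` steps with
the store `s'`. -/
inductive Exec : Prog → Store → ℕ → Store → Prop
  | skip (s : Store) : Exec .skip s 1 s
  | assign (s : Store) (x : ℕ) (e : AExp) :
      Exec (.assign x e) s (e.cost + 1) (s.setVar x (e.val s))
  | put (s : Store) (a : ℕ) (e f : AExp) :
      Exec (.put a e f) s (e.cost + f.cost + 1) (s.setArr a (e.val s) (f.val s))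
  | seq {p q : Prog} {s s' s'' : Store} {t t' : ℕ} :
      Exec p s t s' → Exec q s' t' s'' → Exec (.seq p q) s (t + t') s''
  | cond_true {e : AExp} {p q : Prog} {s s' : Store} {t : ℕ} :
      e.val s ≠ 0 → Exec p s t s' → Exec (.cond e p q) s (e.cost + 1 + t) s'
  | cond_false {e : AExp} {p q : Prog} {s s' : Store} {t : ℕ} :
      e.val s = 0 → Exec q s t s' → Exec (.cond e p q) s (e.cost + 1 + t) s'
  | loop_true {e : AExp} {p : Prog} {s s' s'' : Store} {t t' : ℕ} :
      e.val s ≠ 0 → Exec p s t s' → Exec (.loop e p) s' t' s'' →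
        Exec (.loop e p) s (e.cost + 1 + t + t') s''
  | loop_false {e : AExp} {p : Prog} {s : Store} :
      e.val s = 0 → Exec (.loop e p) s (e.cost + 1) s

/-- The machine is deterministic. -/
theorem Exec.deterministic {p : Prog} {s s₁ s₂ : Store} {t₁ t₂ : ℕ}
    (h₁ : Exec p s t₁ s₁) (h₂ : Exec p s t₂ s₂) : t₁ = t₂ ∧ s₁ = s₂ := by
  induction h₁ generalizing t₂ s₂ with
  | skip => cases h₂; exact ⟨rfl, rfl⟩
  | assign => cases h₂; exact ⟨rfl, rfl⟩
  | put => cases h₂; exact ⟨rfl, rfl⟩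
  | seq _ _ ih ih' =>
    cases h₂ with
    | seq a b =>
      obtain ⟨rfl, rfl⟩ := ih a
      obtain ⟨rfl, rfl⟩ := ih' b
      exact ⟨rfl, rfl⟩
  | cond_true h _ ih =>
    cases h₂ with
    | cond_true _ a => obtain ⟨rfl, rfl⟩ := ih a; exact ⟨rfl, rfl⟩
    | cond_false h' _ => exact absurd h' h
  | cond_false h _ ih =>
    cases h₂ with
    | cond_true h' _ => exact absurd h h'
    | cond_false _ a => obtain ⟨rfl, rfl⟩ := ih a; exact ⟨rfl, rfl⟩
  | loop_true h _ _ ih ih' =>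
    cases h₂ with
    | loop_true _ a b =>
      obtain ⟨rfl, rfl⟩ := ih a
      obtain ⟨rfl, rfl⟩ := ih' b
      exact ⟨rfl, rfl⟩
    | loop_false h' => exact absurd h' h
  | loop_false h =>
    cases h₂ with
    | loop_true h' _ _ => exact absurd h h'
    | loop_false _ => exact ⟨rfl, rfl⟩

end RAM

/-- The initial store for a binary relation `r` on `n` elements: the variable `0` holds `n`, the
array `0` holds the `n × n` matrix of `r` with entries `0` and `1`, row by row, and all other cells
hold `0`. -/
noncomputable def relationInput (n : ℕ) (r : Fin n → Fin n → Prop) : RAM.Store where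
  var x := if x = 0 then n else 0
  arr a m := by
    classical
    exact if a = 0 ∧ ∃ i j : Fin n, m = (i : ℕ) * n + j ∧ r i j then 1 else 0

/-- The approximation factor `n √(log log n) / √(log n)`. -/
noncomputable def approxRate (n : ℕ) : ℝ :=
  n * Real.sqrt (Real.log (Real.log n)) / Real.sqrt (Real.log n)


/-!
Call weights `f j` on a finite poset separating for a set `V` of points if, whenever `v ∈ V` is not
below `y`, some weight of `v` exceeds those of all points of `V` that lie strictly below `y`. If `d`
interval orders realize the order, the right ends of their intervals are `d` separating weights for
every `V`: an interval order that does not put `v` below `y` has `r a ≤ l y < r v` for all `a < y`.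
Conversely, sort all points by the weights found in `V` strictly below them, breaking ties by a
linear extension, and stretch the interval of each point `x` to just before the first point above
`x`. In this interval order extension `v` is not below `y` if the weight of `v` exceeds those of the
points of `V` below `y`. Hence the least numbers of separating weights of sets that cover the poset
add up to at least the interval dimension, while each of them is at most the interval dimension.

The algorithm cuts the list of elements into blocks of `k` elements, where `k ^ (k * k)` is about
`n`, so that `k ^ 2` is of the order of `log n / log (log n)`. Only the ranks of the weights within
a block matter, so there are at most `k ^ (k * k)` candidates to try for each block.
-/

/-! ### Functions computable in polynomial time -/

namespace RAM

universe u

section Store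

variable {w w' x y v : ℕ} {s s' s'' : Store}

/-- The stores `s` and `s'` have the same arrays and the same variables below `w`. Subprograms keep
their intermediate results in the variables from some `w` on, so that they preserve agreement below
`w` with the initial store. -/
def Agree (w : ℕ) (s s' : Store) : Prop :=
  (∀ x < w, s'.var x = s.var x) ∧ s'.arr = s.arr

theorem Agree.refl (w : ℕ) (s : Store) : Agree w s s :=
  ⟨fun _ _ => rfl, rfl⟩

theorem Agree.trans (h : Agree w s s') (h' : Agree w s' s'') : Agree w s s'' :=
  ⟨fun x hx => (h'.1 x hx).trans (h.1 x hx), h'.2.trans h.2⟩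

theorem Agree.mono (h : Agree w' s s') (hw : w ≤ w') : Agree w s s' :=
  ⟨fun x hx => h.1 x (hx.trans_le hw), h.2⟩

theorem setVar_var_self (s : Store) (x v : ℕ) : (s.setVar x v).var x = v :=
  Function.update_self ..

theorem setVar_var_of_ne (s : Store) (h : y ≠ x) (v : ℕ) : (s.setVar x v).var y = s.var y :=
  Function.update_of_ne h ..

theorem agree_setVar (hx : w ≤ x) (s : Store) (v : ℕ) : Agree w s (s.setVar x v) :=
  ⟨fun _ hy => setVar_var_of_ne s (hy.trans_le hx).ne v, rfl⟩

theorem exec_loop {e : AExp} {p : Prog} {I : ℕ → Store → Prop} {N K : ℕ}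
    (he : ∀ m s, I m s → e.val s = N - m)
    (hp : ∀ m < N, ∀ s, I m s → ∃ t s', Exec p s t s' ∧ I (m + 1) s' ∧ t ≤ K)
    (k m : ℕ) (hm : m + k = N) (hs : I m s) :
    ∃ t s', Exec (.loop e p) s t s' ∧ I N s' ∧ t ≤ k * (e.cost + 1 + K) + (e.cost + 1) := by
  induction k generalizing m s with
  | zero =>
    obtain rfl : m = N := hm
    exact ⟨_, s, .loop_false ((he m s hs).trans (Nat.sub_self m)), hs, by omega⟩
  | succ k ih =>
    obtain ⟨t₁, s₁, h₁, hs₁, ht₁⟩ := hp m (by omega) s hs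
    obtain ⟨t₂, s₂, h₂, hs₂, ht₂⟩ := ih (m + 1) (by omega) hs₁
    refine ⟨_, s₂, .loop_true (by have := he m s hs; omega) h₁ h₂, hs₂, ?_⟩
    rw [add_one_mul]
    omega

end Store

/-- A representation of the elements of `ι` by stores. An element may be represented by many stores:
variables from `width` on are free for intermediate results. Polynomial bounds are meant in terms
of `size`. -/
structure Encoding (ι : Type u) where
  /-- the number of variables in use -/
  width : ℕ
  /-- the size of the input that belongs to an element -/
  size : ι → ℕ
  /-- the store represents the element -/
  Holds : ι → Store → Prop
  holds_of_agree : ∀ {a s s'}, Agree width s s' → Holds a s → Holds a s'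

namespace Encoding

variable {ι κ μ : Type u}

/-- The encoding of the elements of `κ` by those of `ι`. -/
def comap (W : Encoding ι) (π : κ → ι) : Encoding κ where
  width := W.width
  size q := W.size (π q)
  Holds q := W.Holds (π q)
  holds_of_agree := W.holds_of_agree

/-- The encoding that extends `W` by the value of `F` in the variable `v`. -/
def push (W : Encoding ι) (v : ℕ) (hv : W.width ≤ v) (F : ι → ℕ) : Encoding ι where
  width := v + 1
  size := W.size
  Holds a s := W.Holds a s ∧ s.var v = F a
  holds_of_agree h hs :=
    ⟨W.holds_of_agree (h.mono (hv.trans v.le_succ)) hs.1, (h.1 v v.lt_succ_self).trans hs.2⟩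

/-- A store that represents `q` in `W'` also represents `π q` in `W`. This relates an encoding to
the encodings in force inside a loop, where the values of loop variables are recorded as well. -/
structure Refines (W' : Encoding κ) (W : Encoding ι) (π : κ → ι) : Prop where
  width_le : W.width ≤ W'.width
  holds : ∀ {q s}, W'.Holds q s → W.Holds (π q) s
  size_eq : ∀ q, W'.size q = W.size (π q)

theorem Refines.trans {W : Encoding ι} {W' : Encoding κ} {W'' : Encoding μ} {π : κ → ι}
    {ρ : μ → κ} (h' : W''.Refines W' ρ) (h : W'.Refines W π) : W''.Refines W (π ∘ ρ) :=
  ⟨h.width_le.trans h'.width_le, fun hs => h.holds (h'.holds hs),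
    fun q => (h'.size_eq q).trans (h.size_eq _)⟩

theorem refines_comap (W : Encoding ι) (π : κ → ι) : (W.comap π).Refines W π :=
  ⟨le_rfl, id, fun _ => rfl⟩

theorem refines_push (W : Encoding ι) {v : ℕ} (hv : W.width ≤ v) (F : ι → ℕ) :
    (W.push v hv F).Refines W id :=
  ⟨hv.trans v.le_succ, And.left, fun _ => rfl⟩

end Encoding

section PolyTime

variable {ι κ : Type u} {W : Encoding ι} {W' : Encoding κ} {π : κ → ι} {F G H N : ι → ℕ}

/-- The values of `F` are bounded by a polynomial in the size. -/
def PolyBounded (W : Encoding ι) (F : ι → ℕ) : Prop :=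
  ∃ T : Polynomial ℕ, ∀ a, F a ≤ T.eval (W.size a)

theorem PolyBounded.mono (hF : PolyBounded W F) (h : ∀ a, G a ≤ F a) : PolyBounded W G :=
  hF.imp fun _ hT a => (h a).trans (hT a)

theorem PolyBounded.const (c : ℕ) : PolyBounded W fun _ => c :=
  ⟨.C c, fun a => (Polynomial.eval_C (x := W.size a)).ge⟩

theorem PolyBounded.add (hF : PolyBounded W F) (hG : PolyBounded W G) :
    PolyBounded W fun a => F a + G a := by
  obtain ⟨T, hT⟩ := hF
  obtain ⟨S, hS⟩ := hG
  exact ⟨T + S, fun a => by rw [Polynomial.eval_add]; exact Nat.add_le_add (hT a) (hS a)⟩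

theorem PolyBounded.mul (hF : PolyBounded W F) (hG : PolyBounded W G) :
    PolyBounded W fun a => F a * G a := by
  obtain ⟨T, hT⟩ := hF
  obtain ⟨S, hS⟩ := hG
  exact ⟨T * S, fun a => by rw [Polynomial.eval_mul]; exact Nat.mul_le_mul (hT a) (hS a)⟩

theorem PolyBounded.lift (hF : PolyBounded W F) (h : W'.Refines W π) :
    PolyBounded W' fun q => F (π q) :=
  hF.imp fun _ hT q => by rw [h.size_eq]; exact hT _

/-- Some program with a polynomial time bound computes `F` into the variable `w`, leaving the
variables below `w` and the arrays as they are. -/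
def Computes (W : Encoding ι) (F : ι → ℕ) (w : ℕ) : Prop :=
  ∃ (p : Prog) (K : ι → ℕ), PolyBounded W K ∧ ∀ a s, W.Holds a s →
    ∃ t s', Exec p s t s' ∧ s'.var w = F a ∧ Agree w s s' ∧ t ≤ K a

theorem Computes.exp {w : ℕ} (e : AExp) (he : ∀ a s, W.Holds a s → e.val s = F a) :
    Computes W F w :=
  ⟨.assign w e, _, .const (e.cost + 1), fun a s hs => ⟨_, _, .assign s w e,
    (setVar_var_self ..).trans (he a s hs), agree_setVar le_rfl .., le_rfl⟩⟩

theorem Computes.seq {v w : ℕ} {hv : W.width ≤ v} (hF : Computes W F v) (hwv : w ≤ v)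
    (hH : Computes (W.push v hv F) H w) : Computes W H w := by
  obtain ⟨p, K, hK, hp⟩ := hF
  obtain ⟨q, L, hL, hq⟩ := hH
  refine ⟨.seq p q, _, hK.add hL, fun a s hs => ?_⟩
  obtain ⟨t₁, s₁, h₁, hF₁, hs₁, ht₁⟩ := hp a s hs
  obtain ⟨t₂, s₂, h₂, hH₂, hs₂, ht₂⟩ := hq a s₁ ⟨W.holds_of_agree (hs₁.mono hv) hs, hF₁⟩
  exact ⟨_, s₂, .seq h₁ h₂, hH₂, (hs₁.mono hwv).trans hs₂, Nat.add_le_add ht₁ ht₂⟩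

/-- `F` can be computed in polynomial time with polynomially bounded values. As the result may be
put into any variable that is not in use, programs can be composed. -/
structure PolyTime (W : Encoding ι) (F : ι → ℕ) : Prop where
  bounded : PolyBounded W F
  computes : ∀ w, W.width ≤ w → Computes W F w

namespace PolyTime

theorem lift (hF : PolyTime W F) (h : W'.Refines W π) : PolyTime W' fun q => F (π q) where
  bounded := hF.bounded.lift h
  computes w hw := by
    obtain ⟨p, K, hK, hp⟩ := hF.computes w (h.width_le.trans hw)
    exact ⟨p, _, hK.lift h, fun q s hs => hp _ s (h.holds hs)⟩

theorem of_exp (e : AExp) (he : ∀ a s, W.Holds a s → e.val s = F a) (hF : PolyBounded W F) :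
    PolyTime W F :=
  ⟨hF, fun _ _ => .exp e he⟩

theorem of_push {v : ℕ} (hv : W.width ≤ v) (hF : PolyBounded W F) : PolyTime (W.push v hv F) F :=
  of_exp (.var v) (fun _ _ hs => hs.2) hF

theorem bind (hF : PolyTime W F) (hH : ∀ v (hv : W.width ≤ v), PolyTime (W.push v hv F) H) :
    PolyTime W H where
  bounded := (hH _ le_rfl).bounded
  computes w hw :=
    have copy : Computes ((W.push w hw F).push (w + 1) le_rfl H) H w :=
      .exp (.var (w + 1)) fun _ _ hs => hs.2
    (hF.computes w hw).seq le_rfl (((hH w hw).computes (w + 1) le_rfl).seq w.le_succ copy)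

theorem bind₂ (hF : PolyTime W F) (hG : PolyTime W G) (e : ℕ → ℕ → AExp)
    (he : ∀ v v' a s, W.Holds a s → s.var v = F a → s.var v' = G a → (e v v').val s = H a)
    (hH : PolyBounded W H) : PolyTime W H :=
  hF.bind fun v hv => (hG.lift (W.refines_push hv F)).bind fun v' _ =>
    of_exp (e v v') (fun a s hs => he v v' a s hs.1.1 hs.1.2 hs.2) hH

theorem const (c : ℕ) : PolyTime W fun _ => c :=
  of_exp (.const c) (fun _ _ _ => rfl) (.const c)

theorem add (hF : PolyTime W F) (hG : PolyTime W G) : PolyTime W fun a => F a + G a :=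
  hF.bind₂ hG (fun v v' => .add (.var v) (.var v'))
    (fun _ _ _ _ _ h h' => congrArg₂ (· + ·) h h') (hF.bounded.add hG.bounded)

theorem sub (hF : PolyTime W F) (hG : PolyTime W G) : PolyTime W fun a => F a - G a :=
  hF.bind₂ hG (fun v v' => .sub (.var v) (.var v'))
    (fun _ _ _ _ _ h h' => congrArg₂ (· - ·) h h') (hF.bounded.mono fun _ => Nat.sub_le _ _)

theorem min (hF : PolyTime W F) (hG : PolyTime W G) : PolyTime W fun a => Min.min (F a) (G a) := by
  simpa only [Nat.sub_sub_eq_min] using hF.sub (hF.sub hG)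

end PolyTime

/-- The encoding of an element `a` together with an index below `N a`, for use inside a loop. The
variable `w` holds the value `g a i` computed so far, and `w + 1` the index `i`. -/
def loopEncoding (W : Encoding ι) (N : ι → ℕ) (g : ι → ℕ → ℕ) (w : ℕ) (hw : W.width ≤ w) :
    Encoding {q : ι × ℕ // q.2 < N q.1} :=
  ((W.comap (Prod.fst ∘ Subtype.val)).push w hw fun q => g q.1.1 q.1.2).push (w + 1) le_rfl
    fun q => q.1.2

theorem loopEncoding_refines (W : Encoding ι) (N : ι → ℕ) (g : ι → ℕ → ℕ) {w : ℕ}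
    (hw : W.width ≤ w) : (loopEncoding W N g w hw).Refines W fun q => q.1.1 :=
  ((Encoding.refines_push _ _ _).trans (Encoding.refines_push _ _ _)).trans
    (W.refines_comap (Prod.fst ∘ Subtype.val))

theorem PolyTime.loop_index (hN : PolyBounded W N) (g : ι → ℕ → ℕ) {w : ℕ} (hw : W.width ≤ w) :
    PolyTime (loopEncoding W N g w hw) fun q => q.1.2 :=
  .of_push _ <| (hN.lift (W.refines_comap (Prod.fst ∘ Subtype.val))).mono fun q => q.2.le

theorem Computes.loop {g : ι → ℕ → ℕ} {w : ℕ} {hw : W.width ≤ w} (hN : PolyBounded W N)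
    (hstep : Computes (loopEncoding W N g w hw) (fun q => g q.1.1 (q.1.2 + 1)) (w + 3)) :
    Computes (((W.push w hw (g · 0)).push (w + 1) le_rfl fun _ => 0).push (w + 2) le_rfl N)
      (fun a => g a (N a)) w := by
  obtain ⟨p, K, ⟨T, hT⟩, hp⟩ := hstep
  let next := Prog.seq (.assign w (.var (w + 3))) (.assign (w + 1) (.add (.var (w + 1)) (.const 1)))
  refine ⟨.loop (.sub (.var (w + 2)) (.var (w + 1))) (.seq p next),
    fun a => N a * (4 + (T.eval (W.size a) + 6)) + 4,
    (hN.mul ((PolyBounded.const 4).add (PolyBounded.add ⟨T, fun _ => le_rfl⟩ (.const 6)))).add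
      (.const 4), ?_⟩
  rintro a s ⟨⟨⟨hs, h0⟩, hi0⟩, hlim⟩
  let I (m : ℕ) (s' : Store) : Prop :=
    Agree w s s' ∧ s'.var w = g a m ∧ s'.var (w + 1) = m ∧ s'.var (w + 2) = N a
  have htest (m : ℕ) (s' : Store) (hI : I m s') :
      (AExp.sub (.var (w + 2)) (.var (w + 1))).val s' = N a - m := by
    simp only [AExp.val, hI.2.2.1, hI.2.2.2]
  have hbody (m : ℕ) (hm : m < N a) (s' : Store) (hI : I m s') :
      ∃ t s'', Exec (.seq p next) s' t s'' ∧ I (m + 1) s'' ∧ t ≤ T.eval (W.size a) + 6 := by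
    obtain ⟨hs', hg, hi, hlim⟩ := hI
    obtain ⟨t, s₁, h₁, hg₁, hs₁, ht⟩ :=
      hp ⟨(a, m), hm⟩ s' ⟨⟨W.holds_of_agree (hs'.mono hw) hs, hg⟩, hi⟩
    refine ⟨_, _, .seq h₁ (.seq (.assign ..) (.assign ..)), ⟨?_, ?_, ?_, ?_⟩,
      Nat.add_le_add_right (ht.trans (hT _)) 6⟩
    · exact ((hs'.trans (hs₁.mono (by omega))).trans (agree_setVar le_rfl ..)).trans
        (agree_setVar w.le_succ ..)
    · rw [setVar_var_of_ne _ (by omega), setVar_var_self]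
      exact hg₁
    · simp only [setVar_var_self, AExp.val]
      rw [setVar_var_of_ne _ (by omega), hs₁.1 _ (by omega), hi]
    · rw [setVar_var_of_ne _ (by omega), setVar_var_of_ne _ (by omega), hs₁.1 _ (by omega), hlim]
  obtain ⟨t, s', h, hI, ht⟩ :=
    exec_loop htest hbody (N a) 0 (zero_add _) ⟨.refl w s, h0, hi0, hlim⟩
  exact ⟨t, s', h, hI.2.1, hI.1, ht⟩

/-- `f a i` can be computed in polynomial time for indices `i` below `N a`, in the form needed for
the body of a loop: the value `f (π q) (i q)` is computable whenever the index `i` is, in every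
refinement of the encoding. -/
def PolyTimeBelow (W : Encoding ι) (N : ι → ℕ) (f : ι → ℕ → ℕ) : Prop :=
  ∀ ⦃κ : Type u⦄ ⦃W' : Encoding κ⦄ ⦃π : κ → ι⦄ ⦃i : κ → ℕ⦄, W'.Refines W π → PolyTime W' i →
    (∀ q, i q < N (π q)) → PolyTime W' fun q => f (π q) (i q)

namespace PolyTime

theorem induction {g : ι → ℕ → ℕ} (hN : PolyTime W N) (h0 : PolyTime W (g · 0))
    (hg : ∃ B, PolyBounded W B ∧ ∀ a, ∀ i ≤ N a, g a i ≤ B a)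
    (hstep : ∀ ⦃κ : Type u⦄ ⦃W' : Encoding κ⦄ ⦃π : κ → ι⦄ ⦃i : κ → ℕ⦄, W'.Refines W π →
      PolyTime W' i → (∀ q, i q < N (π q)) → PolyTime W' (fun q => g (π q) (i q)) →
        PolyTime W' fun q => g (π q) (i q + 1)) :
    PolyTime W fun a => g a (N a) := by
  obtain ⟨B, hB, hgB⟩ := hg
  refine ⟨hB.mono fun a => hgB a _ le_rfl, fun w hw => ?_⟩
  have hgval : PolyTime (loopEncoding W N g w hw) fun q => g q.1.1 q.1.2 :=
    .of_exp (.var w) (fun _ _ hs => hs.1.2)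
      ((hB.lift (loopEncoding_refines W N g hw)).mono fun q => hgB _ _ q.2.le)
  have hbody := hstep (loopEncoding_refines W N g hw) (loop_index hN.bounded g hw)
    (fun q => q.2) hgval
  refine (h0.computes w hw).seq le_rfl (Computes.seq (v := w + 1) (hv := le_rfl) (F := fun _ => 0)
    (.exp (.const 0) fun _ _ _ => rfl) w.le_succ (Computes.seq (v := w + 2) (hv := le_rfl) (F := N)
      ?_ (by omega) (.loop hN.bounded (hbody.computes _ (Nat.le_succ _)))))
  exact (hN.lift ((Encoding.refines_push _ _ _).trans (W.refines_push hw _))).computes _ le_rfl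

theorem sum {f : ι → ℕ → ℕ} (hN : PolyTime W N) (hf : PolyTimeBelow W N f) :
    PolyTime W fun a => ∑ i ∈ Finset.range (N a), f a i := by
  obtain ⟨T, hT⟩ := (hf (loopEncoding_refines W N (fun _ _ => 0) le_rfl)
    (loop_index hN.bounded _ le_rfl) fun q => q.2).bounded
  refine induction (g := fun a m => ∑ i ∈ Finset.range m, f a i) hN
    (by simpa only [Finset.sum_range_zero] using const 0)
    ⟨fun a => N a * T.eval (W.size a), hN.bounded.mul ⟨T, fun _ => le_rfl⟩, fun a m hm => ?_⟩
    fun κ W' π i hW hi hlt hsum => ?_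
  · calc ∑ i ∈ Finset.range m, f a i ≤ m * T.eval (W.size a) := by
          simpa using Finset.sum_le_card_nsmul (Finset.range m) (f a) _ fun i hi =>
            hT ⟨(a, i), (Finset.mem_range.1 hi).trans_le hm⟩
      _ ≤ N a * T.eval (W.size a) := Nat.mul_le_mul_right _ hm
  · simpa only [Finset.sum_range_succ] using hsum.add (hf hW hi hlt)

theorem mul (hF : PolyTime W F) (hG : PolyTime W G) : PolyTime W fun a => F a * G a := by
  simpa only [Finset.sum_const, Finset.card_range, smul_eq_mul] using
    hF.sum (f := fun a _ => G a) fun _ _ _ _ hW _ _ => hG.lift hW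

-- Capping all intermediate powers keeps them polynomially bounded, even where `F a ^ G a` is not.
theorem min_pow (hF : PolyTime W F) (hG : PolyTime W G) (hH : PolyTime W H) :
    PolyTime W fun a => Min.min (F a ^ G a) (H a) := by
  have hsucc (x y m : ℕ) :
      Min.min (x ^ (m + 1)) y = Min.min (Min.min (x ^ m) y * x) y := by
    rcases x.eq_zero_or_pos with rfl | hx
    · simp only [pow_succ, mul_zero]
    · rw [pow_succ, ← Nat.mul_min_mul_right, Nat.min_assoc,
        Nat.min_eq_right (Nat.le_mul_of_pos_right y hx)]
  refine hG.induction (g := fun a i => Min.min (F a ^ i) (H a))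
    (by simpa only [pow_zero] using (const 1).min hH)
    ⟨H, hH.bounded, fun _ _ _ => min_le_right _ _⟩ fun κ W' π i hW _ _ hpow => ?_
  simpa only [hsucc] using (hpow.mul (hF.lift hW)).min (hH.lift hW)

theorem pow_of_le (hF : PolyTime W F) (hG : PolyTime W G) (hH : PolyTime W H)
    (hle : ∀ a, F a ^ G a ≤ H a) : PolyTime W fun a => F a ^ G a := by
  simpa only [min_eq_left (hle _)] using hF.min_pow hG hH

end PolyTime

open Classical in
/-- The number that represents the truth value of a proposition. -/
noncomputable def truthValue (P : Prop) : ℕ := if P then 1 else 0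

theorem truthValue_not (P : Prop) : truthValue (¬ P) = 1 - truthValue P := by
  by_cases hP : P <;> simp only [truthValue, hP, not_true, not_false_eq_true, if_true, if_false]

theorem truthValue_and (P Q : Prop) : truthValue (P ∧ Q) = truthValue P * truthValue Q := by
  by_cases hP : P <;> by_cases hQ : Q <;> simp [truthValue, hP, hQ]

theorem truthValue_ne_zero (n : ℕ) : truthValue (n ≠ 0) = 1 - (1 - n) := by
  by_cases hn : n = 0
  · simp [truthValue, hn]
  · simp only [truthValue, ne_eq, hn, not_false_eq_true, if_true]
    omega

theorem sum_truthValue_ne_zero {n : ℕ} {P : ℕ → Prop} :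
    ∑ i ∈ Finset.range n, truthValue (P i) ≠ 0 ↔ ∃ i < n, P i := by
  simp [truthValue]

theorem sum_truthValue_lt {m n : ℕ} (h : m ≤ n) :
    ∑ i ∈ Finset.range n, truthValue (i < m) = m := by
  have heq : ∑ i ∈ Finset.range m, 1 = ∑ i ∈ Finset.range n, truthValue (i < m) :=
    Finset.sum_subset_zero_on_sdiff (Finset.range_subset_range.2 h)
      (fun i hi => by simp_all [truthValue]) fun i hi => by simp_all [truthValue]
  simpa using heq.symm

/-- The predicate `P` can be decided in polynomial time. -/
def PolyTimePred (W : Encoding ι) (P : ι → Prop) : Prop :=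
  PolyTime W fun a => truthValue (P a)

/-- `PolyTimeBelow` for predicates. -/
def PolyTimePredBelow (W : Encoding ι) (N : ι → ℕ) (P : ι → ℕ → Prop) : Prop :=
  PolyTimeBelow W N fun a i => truthValue (P a i)

namespace PolyTimePred

variable {P Q : ι → Prop}

theorem congr (hP : PolyTimePred W P) (h : ∀ a, Q a ↔ P a) : PolyTimePred W Q :=
  (funext fun a => propext (h a) : Q = P) ▸ hP

theorem ne_zero (hF : PolyTime W F) : PolyTimePred W fun a => F a ≠ 0 := by
  simpa only [PolyTimePred, truthValue_ne_zero] using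
    (PolyTime.const 1).sub ((PolyTime.const 1).sub hF)

theorem not (hP : PolyTimePred W P) : PolyTimePred W fun a => ¬ P a := by
  simpa only [PolyTimePred, truthValue_not] using (PolyTime.const 1).sub hP

theorem and (hP : PolyTimePred W P) (hQ : PolyTimePred W Q) :
    PolyTimePred W fun a => P a ∧ Q a := by
  simpa only [PolyTimePred, truthValue_and] using PolyTime.mul hP hQ

theorem imp (hP : PolyTimePred W P) (hQ : PolyTimePred W Q) :
    PolyTimePred W fun a => P a → Q a :=
  (hP.and hQ.not).not.congr fun _ => by tauto

theorem lt (hF : PolyTime W F) (hG : PolyTime W G) : PolyTimePred W fun a => F a < G a :=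
  (ne_zero (hG.sub hF)).congr fun _ => by omega

theorem lt_pow (hF : PolyTime W F) (hG : PolyTime W G) (hH : PolyTime W H) :
    PolyTimePred W fun a => F a < G a ^ H a :=
  (lt hF (hG.min_pow hH (hF.add (.const 1)))).congr fun _ =>
    (lt_min_iff.trans (and_iff_left (Nat.lt_succ_self _))).symm

theorem le (hF : PolyTime W F) (hG : PolyTime W G) : PolyTimePred W fun a => F a ≤ G a :=
  (lt hG hF).not.congr fun _ => by omega

theorem eq (hF : PolyTime W F) (hG : PolyTime W G) : PolyTimePred W fun a => F a = G a :=
  ((le hF hG).and (le hG hF)).congr fun _ => le_antisymm_iff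

theorem exists_lt {P : ι → ℕ → Prop} (hN : PolyTime W N) (hP : PolyTimePredBelow W N P) :
    PolyTimePred W fun a => ∃ i < N a, P a i :=
  (ne_zero (hN.sum hP)).congr fun _ => sum_truthValue_ne_zero.symm

theorem exists_fin {P : ι → ℕ → Prop} (hN : PolyTime W N) (hP : PolyTimePredBelow W N P) :
    PolyTimePred W fun a => ∃ i : Fin (N a), P a i :=
  (exists_lt hN hP).congr fun _ => by simp only [Fin.exists_iff, exists_prop]

theorem forall_lt {P : ι → ℕ → Prop} (hN : PolyTime W N) (hP : PolyTimePredBelow W N P) :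
    PolyTimePred W fun a => ∀ i < N a, P a i :=
  (exists_lt (P := fun a i => ¬ P a i) hN fun _ _ _ _ hW hi hlt => not (hP hW hi hlt)).not.congr
    fun a => by push Not; rfl

end PolyTimePred

namespace PolyTime

theorem of_pred_lt (hN : PolyTime W N) (hF : ∀ a, F a ≤ N a)
    (h : PolyTimePredBelow W N fun a i => i < F a) : PolyTime W F := by
  simpa only [sum_truthValue_lt (hF _)] using hN.sum h

theorem div (hF : PolyTime W F) (hG : PolyTime W G) : PolyTime W fun a => F a / G a := by
  refine hF.of_pred_lt (fun a => Nat.div_le_self _ _) fun κ W' π i hW hi _ => ?_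
  refine ((PolyTimePred.lt (const 0) (hG.lift hW)).and
    (.le ((hi.add (const 1)).mul (hG.lift hW)) (hF.lift hW))).congr fun q => ?_
  rcases (G (π q)).eq_zero_or_pos with h0 | hpos
  · simp only [h0, Nat.div_zero, Nat.not_lt_zero, lt_self_iff_false, false_and]
  · exact (Nat.le_div_iff_mul_le hpos).trans (and_iff_right hpos).symm

theorem mod (hF : PolyTime W F) (hG : PolyTime W G) : PolyTime W fun a => F a % G a := by
  simpa only [Nat.mod_eq_sub_mul_div] using hF.sub (hG.mul (hF.div hG))

theorem sInf {P : ι → ℕ → Prop} (hN : PolyTime W N) (hex : ∀ a, ∃ i ≤ N a, P a i)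
    (hP : PolyTimePredBelow W N P) : PolyTime W fun a => sInf {i | P a i} := by
  refine hN.of_pred_lt (fun a => ?_) fun κ W' π i hW hi hlt => ?_
  · obtain ⟨i, hi, hPi⟩ := hex a
    exact (Nat.sInf_le hPi).trans hi
  · refine (PolyTimePred.forall_lt (P := fun q j => ¬ P (π q) j) (hi.add (const 1))
      fun κ W'' ρ j hW' hj hlt' => PolyTimePred.not (hP (hW'.trans hW) hj fun q =>
        (Nat.lt_succ_iff.1 (hlt' q)).trans_lt (hlt _))).congr fun q => ?_
    refine ⟨fun h j hj => Nat.notMem_of_lt_sInf ((Nat.lt_succ_iff.1 hj).trans_lt h), fun h => ?_⟩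
    obtain ⟨m, -, hm⟩ := hex (π q)
    by_contra! hle
    exact h _ (Nat.lt_succ_iff.2 hle) (Nat.sInf_mem ⟨m, hm⟩)

end PolyTime

end PolyTime

end RAM

/-! ### Separating weights -/

section IntervalRealizer

variable {X : Type*} [PartialOrder X]

theorem isIntervalOrder_of_strictMono [Finite X] {L : Type*} [LinearOrder L] {l : X → L}
    (hl : StrictMono l) : IsIntervalOrder fun x y => x = y ∨ ∃ z, x < z ∧ l z ≤ l y := by
  let left (x : X) : Set X := {a | l a < l x}
  let right (x : X) : Set X := {a | ∀ z, x < z → l a < l z}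
  have hlr (x y : X) (h : ∀ z, x < z → l y < l z) : (left y).ncard < (right x).ncard :=
    Set.ncard_lt_ncard (ssubset_of_subset_of_ne (fun a ha z hz => ha.trans (h z hz))
      fun heq => lt_irrefl (l y) (heq.ge h))
  refine ⟨{ refl := fun x => .inl rfl, trans := ?_, antisymm := ?_ }, fun x => (left x).ncard,
    fun x => (right x).ncard, fun x => Nat.cast_lt.2 (hlr x x fun _ hz => hl hz),
    fun x y hxy => ?_⟩
  · rintro x y w (rfl | ⟨z, hxz, hzy⟩) (rfl | ⟨z', hyz', hzw⟩)
    · exact .inl rfl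
    · exact .inr ⟨z', hyz', hzw⟩
    · exact .inr ⟨z, hxz, hzy⟩
    · exact .inr ⟨z, hxz, hzy.trans ((hl hyz').le.trans hzw)⟩
  · rintro x y (rfl | ⟨z, hxz, hzy⟩) (h | ⟨z', hyz', hzx⟩)
    · rfl
    · rfl
    · exact h.symm
    · exact absurd (((hl hxz).trans_le hzy).trans ((hl hyz').trans_le hzx)) (lt_irrefl _)
  · refine (or_iff_right hxy).trans (Iff.trans ?_ Nat.cast_le.symm)
    constructor
    · rintro ⟨z, hxz, hzy⟩
      exact Set.ncard_le_ncard fun a ha => (ha z hxz).trans_le hzy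
    · contrapose!
      exact hlr x y

theorem exists_intervalOrder_of_weight [Finite X] {α : Type*} [LinearOrder α] (V : Set X)
    (f : X → α) :
    ∃ r : X → X → Prop, IsIntervalOrder r ∧ (∀ x y, x ≤ y → r x y) ∧
      ∀ v ∈ V, ∀ y, ¬ v ≤ y → (∀ a ∈ V, a < y → f a < f v) → ¬ r v y := by
  let weightsBelow (x : X) : LowerSet α := lowerClosure (f '' {a ∈ V | a < x})
  let l (x : X) : LowerSet α ×ₗ LinearExtension X := toLex (weightsBelow x, toLinearExtension x)
  have hl : StrictMono l := fun x y hxy => Prod.Lex.toLex_lt_toLex'.2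
    ⟨lowerClosure_mono (Set.image_mono fun _ ha => ⟨ha.1, ha.2.trans hxy⟩), fun _ =>
      (toLinearExtension.monotone hxy.le).lt_of_ne hxy.ne⟩
  refine ⟨_, isIntervalOrder_of_strictMono hl, fun x y hxy => ?_, ?_⟩
  · exact hxy.eq_or_lt.imp_right fun hlt => ⟨y, hlt, le_rfl⟩
  · rintro v hv y hvy hsep (rfl | ⟨z, hvz, hzy⟩)
    · exact hvy le_rfl
    · have hmem : f v ∈ weightsBelow y :=
        (Prod.Lex.toLex_le_toLex'.1 hzy).1 (subset_lowerClosure ⟨v, ⟨hv, hvz⟩, rfl⟩)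
      obtain ⟨-, ⟨a, ⟨ha, hay⟩, rfl⟩, hle⟩ := mem_lowerClosure.1 hmem
      exact (hsep a ha hay).not_ge hle

end IntervalRealizer

/-- The weights `f j` separate the set `V` of points from the order: whenever `v ∈ V` is not below
`y`, some weight of `v` exceeds those of all points of `V` that lie strictly below `y`. -/
def IsSeparating {X J α : Type*} [Preorder X] [LT α] (V : Set X) (f : J → X → α) : Prop :=
  ∀ v ∈ V, ∀ y, ¬ v ≤ y → ∃ j, ∀ a ∈ V, a < y → f j a < f j v

section IsSeparating

variable {X J α : Type*}

theorem IsSeparating.mono [Preorder X] [LT α] {U V : Set X} {f : J → X → α}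
    (h : IsSeparating V f) (hUV : U ⊆ V) : IsSeparating U f := fun v hv y hvy =>
  (h v (hUV hv) y hvy).imp fun _ hj a ha => hj a (hUV ha)

theorem IsSeparating.congr [Preorder X] [LT α] {V : Set X} {f g : J → X → α}
    (h : IsSeparating V f) (hfg : ∀ j, V.EqOn (f j) (g j)) : IsSeparating V g :=
  fun v hv y hvy => (h v hv y hvy).imp fun j hj a ha hay => by
    simpa only [hfg j ha, hfg j hv] using hj a ha hay

theorem IsSeparating.exists_rank [Preorder X] [Preorder α] {V : Set X} {f : J → X → α}
    (h : IsSeparating V f) (hV : V.Finite) :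
    ∃ g : J → X → ℕ, IsSeparating V g ∧ ∀ j, ∀ v ∈ V, g j v < V.ncard := by
  let lower (j : J) (x : X) : Set X := {a ∈ V | f j a < f j x}
  have hfin (j : J) (x : X) : (lower j x).Finite := hV.subset (Set.sep_subset _ _)
  refine ⟨fun j x => (lower j x).ncard, fun v hv y hvy => ?_, fun j v hv => ?_⟩
  · refine (h v hv y hvy).imp fun j hj a ha hay => Set.ncard_lt_ncard ?_ (hfin j v)
    exact ⟨fun b hb => ⟨hb.1, hb.2.trans (hj a ha hay)⟩,
      fun hsub => lt_irrefl _ (hsub ⟨ha, hj a ha hay⟩).2⟩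
  · exact Set.ncard_lt_ncard ⟨Set.sep_subset _ _, fun hsub => lt_irrefl _ (hsub hv).2⟩ hV

theorem exists_isSeparating_of_injOn [Preorder X] {V : Set X} {label : X → ℕ} {k : ℕ}
    (hinj : V.InjOn label) (hlt : ∀ v ∈ V, label v < k) :
    ∃ f : Fin k → X → ℕ, IsSeparating V f := by
  refine ⟨fun j x => if label x = j then 1 else 0, fun v hv y hvy => ⟨⟨label v, hlt v hv⟩,
    fun a ha hay => ?_⟩⟩
  have hav : label a ≠ label v := fun heq => hvy (hinj ha hv heq ▸ hay.le)
  simp only [hav, if_true, if_false, Nat.one_pos]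

theorem HasIntervalRealizer.exists_isSeparating [PartialOrder X] {d : ℕ}
    (h : HasIntervalRealizer (fun x y : X => x ≤ y) d) :
    ∃ f : Fin d → X → ℝ, IsSeparating Set.univ f := by
  obtain ⟨Q, hQ, hext, hinter⟩ := h
  choose _ l u _ hQlu using hQ
  refine ⟨u, fun v _ y hvy => ?_⟩
  obtain ⟨i, hi⟩ : ∃ i, ¬ Q i v y := by simpa only [hinter, not_forall] using hvy
  refine ⟨i, fun a _ hay => ?_⟩
  have hvy' : v ≠ y := fun heq => hvy heq.le
  calc u i a ≤ l i y := (hQlu i a y hay.ne).1 (hext i a y hay.le)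
    _ < u i v := not_le.1 (mt (hQlu i v y hvy').2 hi)

theorem hasIntervalRealizer_of_isSeparating [PartialOrder X] [Finite X] [LinearOrder α]
    {β : Type*} [Fintype β] {V : β → Set X} (hV : ∀ x, ∃ b, x ∈ V b) {c : β → ℕ}
    {f : ∀ b, Fin (c b) → X → α} (hf : ∀ b, IsSeparating (V b) (f b)) :
    HasIntervalRealizer (fun x y : X => x ≤ y) (∑ b, c b) := by
  choose r hr hext hsep using fun p : Σ b, Fin (c b) =>
    exists_intervalOrder_of_weight (V p.1) (f p.1 p.2)
  let e : (Σ b, Fin (c b)) ≃ Fin (∑ b, c b) := Fintype.equivFinOfCardEq (by simp)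
  refine ⟨fun i => r (e.symm i), fun _ => hr _, fun _ => hext _, fun x y =>
    ⟨fun h _ => hext _ x y h, fun h => ?_⟩⟩
  by_contra hxy
  obtain ⟨b, hb⟩ := hV x
  obtain ⟨j, hj⟩ := hf b x hb y hxy
  have hr : r ⟨b, j⟩ x y := e.symm_apply_apply ⟨b, j⟩ ▸ h (e ⟨b, j⟩)
  exact hsep ⟨b, j⟩ x hb y hxy hj hr

end IsSeparating

/-- The least positive number of weights that separate `V`. -/
noncomputable def separationNumber {X : Type*} [Preorder X] (V : Set X) : ℕ :=
  sInf {c | 0 < c ∧ ∃ f : Fin c → X → ℕ, IsSeparating V f}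

section SeparationNumber

variable {X : Type*}

theorem separationNumber_spec [Preorder X] [Finite X] (V : Set X) :
    0 < separationNumber V ∧ ∃ f : Fin (separationNumber V) → X → ℕ, IsSeparating V f :=
  Nat.sInf_mem (s := {c | 0 < c ∧ ∃ f : Fin c → X → ℕ, IsSeparating V f}) ⟨Nat.card X + 1,
    Nat.succ_pos _, exists_isSeparating_of_injOn (label := fun x => Finite.equivFin X x)
      (fun _ _ _ _ h => (Finite.equivFin X).injective (Fin.ext h))
      fun v _ => (Finite.equivFin X v).2.trans (Nat.lt_succ_self _)⟩

theorem separationNumber_le_intervalDim [PartialOrder X] [Finite X] (V : Set X) :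
    separationNumber V ≤ intervalDim X := by
  obtain ⟨hpos, hreal⟩ := intervalDim_spec X
  obtain ⟨f, hf⟩ := hreal.exists_isSeparating
  obtain ⟨g, hg, -⟩ := (hf.mono V.subset_univ).exists_rank V.toFinite
  exact Nat.sInf_le ⟨hpos, g, hg⟩

theorem intervalDim_le_sum_separationNumber [PartialOrder X] [Finite X] {β : Type*} [Fintype β]
    [Nonempty β] {V : β → Set X} (hV : ∀ x, ∃ b, x ∈ V b) :
    intervalDim X ≤ ∑ b, separationNumber (V b) := by
  choose hpos f hf using fun b => separationNumber_spec (V b)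
  exact Nat.sInf_le ⟨Finset.sum_pos (fun b _ => hpos b) Finset.univ_nonempty,
    hasIntervalRealizer_of_isSeparating hV hf⟩

end SeparationNumber

/-! ### Weights coded as numbers -/

/-- The digit of `g` in base `k` at the position `i`. -/
def digit (k g i : ℕ) : ℕ := g / k ^ i % k

theorem exists_lt_pow_digit_eq {k n : ℕ} (F : Fin n → Fin k) :
    ∃ g < k ^ n, ∀ i : Fin n, digit k g i = F i := by
  obtain ⟨g, rfl⟩ := finFunctionFinEquiv.symm.surjective F
  exact ⟨g, g.2, fun _ => rfl⟩

theorem exists_isSeparating_iff_table {X : Type*} [Preorder X] {V : Set X} {label : X → ℕ} {k : ℕ}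
    (hinj : V.InjOn label) (hlt : ∀ v ∈ V, label v < k) (c : ℕ) :
    (∃ f : Fin c → X → ℕ, IsSeparating V f) ↔
      ∃ g < k ^ (c * k), IsSeparating V fun (j : Fin c) x => digit k g (label x + k * j) := by
  refine ⟨fun ⟨f, hf⟩ => ?_, fun ⟨g, _, hg⟩ => ⟨_, hg⟩⟩
  have hV : V.Finite :=
    .of_injOn (t := Set.Iio k) hlt hinj (Set.finite_Iio k)
  have hcard : V.ncard ≤ k := by
    simpa using Set.ncard_le_ncard_of_injOn (t := Set.Iio k) label hlt hinj
  obtain ⟨r, hr, hrV⟩ := hf.exists_rank hV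
  let position (p : Fin c × V) : Fin (c * k) := finProdFinEquiv (p.1, ⟨label p.2, hlt _ p.2.2⟩)
  have hposition : Function.Injective position := fun p q hpq => by
    have hpq' := finProdFinEquiv.injective hpq
    simp only [Prod.mk.injEq, Fin.mk.injEq] at hpq'
    exact Prod.ext hpq'.1 (Subtype.ext (hinj p.2.2 q.2.2 hpq'.2))
  obtain ⟨g, hg, hdigit⟩ := exists_lt_pow_digit_eq <| Function.extend position
    (fun p => (⟨r p.1 p.2, (hrV _ _ p.2.2).trans_le hcard⟩ : Fin k)) Fin.modNat
  refine ⟨g, hg, hr.congr fun j x hx => ?_⟩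
  have := hdigit (position (j, ⟨x, hx⟩))
  rw [hposition.extend_apply] at this
  exact this.symm

/-! ### The algorithm -/

theorem RAM.polyTime_digit {ι : Type*} {W : RAM.Encoding ι} {K G I : ι → ℕ}
    (hK : RAM.PolyTime W K) (hG : RAM.PolyTime W G) (hI : RAM.PolyTime W I) :
    RAM.PolyTime W fun a => digit (K a) (G a) (I a) := by
  have hdigit (k g i : ℕ) : digit k g i = g / min (k ^ i) (g + 1) % k := by
    rcases le_or_gt (k ^ i) g with h | h
    · rw [digit, min_eq_left (h.trans g.le_succ)]
    · rw [digit, min_eq_right h, Nat.div_eq_of_lt h, Nat.div_eq_of_lt g.lt_succ_self]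
  simpa only [hdigit] using (hG.div (hK.min_pow hI (hG.add (.const 1)))).mod hK

theorem relationInput_arr {n : ℕ} (r : Fin n → Fin n → Prop) (i j : Fin n) :
    (relationInput n r).arr 0 (i * n + j) = RAM.truthValue (r i j) := by
  have hentry : (∃ i' j' : Fin n, (i * n + j : ℕ) = i' * n + j' ∧ r i' j') ↔ r i j := by
    refine ⟨?_, fun h => ⟨i, j, rfl, h⟩⟩
    rintro ⟨i', j', heq, hr⟩
    have hpair : (i, j) = (i', j') := finProdFinEquiv.injective <| Fin.ext <| by
      simpa only [finProdFinEquiv_apply_val, mul_comm n, add_comm] using heq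
    obtain ⟨rfl, rfl⟩ := Prod.mk.inj hpair
    exact hr
  by_cases hr : r i j <;> simp [relationInput, RAM.truthValue, hentry, hr]

universe u

/-- A poset with `n` elements, listed in an arbitrary order: the input of the algorithm. -/
structure ListedPoset : Type (u + 1) where
  /-- the number of elements -/
  n : ℕ
  /-- the type of the elements -/
  carrier : Type u
  [order : PartialOrder carrier]
  /-- the list of the elements -/
  enum : Fin n ≃ carrier

namespace ListedPoset

open RAM

attribute [instance] order

instance (P : ListedPoset) : Finite P.carrier := .of_equiv _ P.enum

/-- The position of an element in the list. -/
def index (P : ListedPoset) (x : P.carrier) : ℕ := P.enum.symm x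

theorem index_lt (P : ListedPoset) (x : P.carrier) : P.index x < P.n := (P.enum.symm x).2

theorem index_injective (P : ListedPoset) : Function.Injective P.index :=
  Fin.val_injective.comp P.enum.symm.injective

theorem index_enum (P : ListedPoset) (i : Fin P.n) : P.index (P.enum i) = i :=
  congrArg Fin.val (P.enum.symm_apply_apply i)

/-- The `b`-th of the blocks of `k` consecutive elements into which the list is cut. -/
def block (P : ListedPoset) (k b : ℕ) : Set P.carrier := {x | P.index x / k = b}

theorem index_mod_injOn_block (P : ListedPoset) (k b : ℕ) :
    (P.block k b).InjOn fun x => P.index x % k := fun x hx y hy hxy =>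
  P.index_injective <| by
    rw [← Nat.div_add_mod (P.index x) k, ← Nat.div_add_mod (P.index y) k, hx, hy]
    exact congrArg (k * b + ·) hxy

/-- The `j`-th of the weights that the number `g` codes for each block of `k` elements: their
values at the elements of a block are the digits of `g` in base `k` from the position `k * j` on. -/
def weight (P : ListedPoset) (k g j : ℕ) (x : P.carrier) : ℕ :=
  digit k g (P.index x % k + k * j)

/-- The representation of the input in the initial store of a program. -/
def encoding : Encoding ListedPoset.{u} where
  width := 1
  size := n
  Holds P s := s.var 0 = P.n ∧
    s.arr 0 = (relationInput P.n fun i j => P.enum i ≤ P.enum j).arr 0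
  holds_of_agree h hs := ⟨(h.1 0 Nat.one_pos).trans hs.1, (congrFun h.2 0).trans hs.2⟩

theorem polyTime_n : PolyTime encoding.{u} n :=
  .of_exp (.var 0) (fun _ _ hs => hs.1) ⟨.X, fun _ => (Polynomial.eval_X).ge⟩

section Refines

variable {κ : Type (u + 1)} {W : Encoding κ} {π : κ → ListedPoset.{u}}

theorem polyTimePred_le (hW : W.Refines encoding π) {x y : ∀ q, (π q).carrier}
    (hx : PolyTime W fun q => (π q).index (x q)) (hy : PolyTime W fun q => (π q).index (y q)) :
    PolyTimePred W fun q => x q ≤ y q := by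
  refine ((hx.mul (polyTime_n.lift hW)).add hy).bind fun v _ =>
    .of_exp (.get 0 (.var v)) (fun q s hs => ?_) ((PolyBounded.const 1).mono fun q => ?_)
  · have hentry := relationInput_arr (fun i j => (π q).enum i ≤ (π q).enum j)
      ((π q).enum.symm (x q)) ((π q).enum.symm (y q))
    simp only [Equiv.apply_symm_apply] at hentry
    simp only [AExp.val, hs.2, (hW.holds hs.1).2]
    exact hentry
  · unfold truthValue
    split_ifs <;> simp

theorem polyTimePred_lt (hW : W.Refines encoding π) {x y : ∀ q, (π q).carrier}
    (hx : PolyTime W fun q => (π q).index (x q)) (hy : PolyTime W fun q => (π q).index (y q)) :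
    PolyTimePred W fun q => x q < y q :=
  ((polyTimePred_le hW hx hy).and (polyTimePred_le hW hy hx).not).congr fun _ => lt_iff_le_not_ge

theorem polyTimePred_forall (hW : W.Refines encoding π) {P : ∀ q, (π q).carrier → Prop}
    (hP : ∀ ⦃κ' : Type (u + 1)⦄ ⦃W' : Encoding κ'⦄ ⦃ρ : κ' → κ⦄ ⦃x : ∀ r, (π (ρ r)).carrier⦄,
      W'.Refines W ρ → PolyTime W' (fun r => (π (ρ r)).index (x r)) →
        PolyTimePred W' fun r => P (ρ r) (x r)) :
    PolyTimePred W fun q => ∀ x, P q x := by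
  refine (PolyTimePred.forall_lt (P := fun q i => ∀ hi : i < (π q).n, P q ((π q).enum ⟨i, hi⟩))
    (polyTime_n.lift hW) fun κ' W' ρ i hW' hi hlt => ?_).congr fun q => ?_
  · refine (hP (x := fun r => (π (ρ r)).enum ⟨i r, hlt r⟩) hW' ?_).congr fun r =>
      forall_prop_of_true (hlt r)
    simpa only [index_enum] using hi
  · exact ((π q).enum.forall_congr_right (q := P q)).symm.trans
      ⟨fun h i hi _ => h ⟨i, hi⟩, fun h i => h i i.2 i.2⟩

theorem polyTime_weight {K G J : κ → ℕ} {x : ∀ q, (π q).carrier}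
    (hK : PolyTime W K) (hG : PolyTime W G) (hJ : PolyTime W J)
    (hx : PolyTime W fun q => (π q).index (x q)) :
    PolyTime W fun q => (π q).weight (K q) (G q) (J q) (x q) :=
  polyTime_digit hK hG ((hx.mod hK).add (hK.mul hJ))

theorem polyTimePred_isSeparating (hW : W.Refines encoding π) {K B C G : κ → ℕ}
    (hK : PolyTime W K) (hB : PolyTime W B) (hC : PolyTime W C) (hG : PolyTime W G) :
    PolyTimePred W fun q => IsSeparating ((π q).block (K q) (B q))
      fun j : Fin (C q) => (π q).weight (K q) (G q) j := by
  refine polyTimePred_forall hW fun κ₁ W₁ ρ₁ v h₁ hv => ?_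
  refine .imp (.eq (hv.div (hK.lift h₁)) (hB.lift h₁)) ?_
  refine polyTimePred_forall (h₁.trans hW) fun κ₂ W₂ ρ₂ y h₂ hy => ?_
  have h₁₂ := h₂.trans h₁
  refine .imp (polyTimePred_le (h₁₂.trans hW) (hv.lift h₂) hy).not ?_
  refine .exists_fin (P := fun r j => ∀ a ∈ (π (ρ₁ (ρ₂ r))).block (K _) (B _), a < y r →
    (π _).weight (K (ρ₁ (ρ₂ r))) (G (ρ₁ (ρ₂ r))) j a <
      (π _).weight (K (ρ₁ (ρ₂ r))) (G (ρ₁ (ρ₂ r))) j (v (ρ₂ r))) (hC.lift h₁₂)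
    fun κ₃ W₃ ρ₃ j h₃ hj _ => ?_
  refine polyTimePred_forall (h₃.trans (h₁₂.trans hW)) fun κ₄ W₄ ρ₄ a h₄ ha => ?_
  have h₂₄ := h₄.trans h₃
  have h := h₂₄.trans h₁₂
  have hK' := hK.lift h
  have hG' := hG.lift h
  refine .imp (.eq (ha.div hK') (hB.lift h)) (.imp ?_ (.lt ?_ ?_))
  · exact polyTimePred_lt (h.trans hW) ha (hy.lift h₂₄)
  · exact polyTime_weight hK' hG' (hj.lift h₄) ha
  · exact polyTime_weight hK' hG' (hj.lift h₄) (hv.lift (h₂₄.trans h₂))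

theorem polyTime_separationNumber_block (hW : W.Refines encoding π) {K B M : κ → ℕ}
    (hK : PolyTime W K) (hB : PolyTime W B) (hM : PolyTime W M) (hpos : ∀ q, 0 < K q)
    (hle : ∀ q, K q ^ (K q * K q) ≤ M q) :
    PolyTime W fun q => separationNumber ((π q).block (K q) (B q)) := by
  unfold separationNumber
  refine PolyTime.sInf hK (fun q => ⟨K q, le_rfl, hpos q, exists_isSeparating_of_injOn
    ((π q).index_mod_injOn_block _ _) fun v _ => Nat.mod_lt _ (hpos q)⟩)
    fun κ' W' ρ c h hc hlt => ?_
  have hK' := hK.lift h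
  have hpow : PolyTime W' fun r => K (ρ r) ^ (c r * K (ρ r)) :=
    hK'.pow_of_le (hc.mul hK') (hM.lift h) fun r =>
      (Nat.pow_le_pow_right (hpos _) (Nat.mul_le_mul_right _ (hlt r).le)).trans (hle _)
  refine PolyTimePred.and (.lt (.const 0) hc) ((PolyTimePred.exists_lt (P := fun r g => IsSeparating
    ((π (ρ r)).block (K (ρ r)) (B (ρ r))) fun j : Fin (c r) => (π (ρ r)).weight (K (ρ r)) g j) hpow
      fun κ'' W'' σ g h' hg _ => polyTimePred_isSeparating (h'.trans (h.trans hW)) (hK'.lift h')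
        ((hB.lift h).lift h') (hc.lift h') hg).congr fun r => ?_)
  exact exists_isSeparating_iff_table ((π _).index_mod_injOn_block _ _)
    (fun v _ => Nat.mod_lt _ (hpos _)) _

end Refines

end ListedPoset

/-- The size of the blocks: for `n ≠ 0` the greatest `k` with `k ^ (k * k) ≤ n`, so that all tables
of `k` weights below `k` for the `k` elements of a block can be tried in polynomial time. -/
noncomputable def blockSize (n : ℕ) : ℕ :=
  sInf {k | 0 < k ∧ n < (k + 1) ^ ((k + 1) * (k + 1))}

theorem lt_succ_pow_mul_self (n : ℕ) : n < (n + 1 + 1) ^ ((n + 1 + 1) * (n + 1 + 1)) :=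
  n.lt_two_pow_self.trans_le <|
    (Nat.pow_le_pow_left (Nat.le_add_left 2 n) n).trans <| Nat.pow_le_pow_right (Nat.succ_pos _) <|
      (Nat.le_add_right n 2).trans (Nat.le_mul_self _)

theorem blockSize_spec (n : ℕ) :
    0 < blockSize n ∧ n < (blockSize n + 1) ^ ((blockSize n + 1) * (blockSize n + 1)) :=
  Nat.sInf_mem (s := {k | 0 < k ∧ n < (k + 1) ^ ((k + 1) * (k + 1))})
    ⟨n + 1, n.succ_pos, lt_succ_pow_mul_self n⟩

theorem blockSize_pow_le (n : ℕ) : blockSize n ^ (blockSize n * blockSize n) ≤ max 1 n := by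
  obtain ⟨k, hk⟩ := Nat.exists_eq_succ_of_ne_zero (blockSize_spec n).1.ne'
  rcases k.eq_zero_or_pos with rfl | hpos
  · simp only [hk, Nat.succ_eq_add_one, zero_add, one_pow, le_max_left]
  · have hmem : ¬ (0 < k ∧ n < (k + 1) ^ ((k + 1) * (k + 1))) :=
      Nat.notMem_of_lt_sInf (hk ▸ k.lt_succ_self : k < blockSize n)
    rw [hk]
    exact le_max_of_le_right (not_lt.1 fun h => hmem ⟨hpos, h⟩)

/-- The number of blocks; the last one may be empty. -/
noncomputable def numBlocks (n : ℕ) : ℕ := n / blockSize n + 1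

namespace ListedPoset

open RAM

theorem polyTime_blockSize : PolyTime encoding.{u} fun P => blockSize P.n := by
  refine PolyTime.sInf (polyTime_n.add (.const 1)) (fun P => ⟨P.n + 1, le_rfl, P.n.succ_pos,
    lt_succ_pow_mul_self P.n⟩) fun κ W π k h hk _ => ?_
  have hk1 := hk.add (.const 1)
  exact PolyTimePred.and (.lt (.const 0) hk) (.lt_pow (polyTime_n.lift h) hk1 (hk1.mul hk1))

/-- The value that the algorithm returns: the sum of the separation numbers of all blocks. -/
noncomputable def separationSum (P : ListedPoset) : ℕ :=
  ∑ b ∈ Finset.range (numBlocks P.n), separationNumber (P.block (blockSize P.n) b)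

theorem polyTime_separationSum : PolyTime encoding.{u} separationSum := by
  refine PolyTime.sum ((polyTime_n.div polyTime_blockSize).add (.const 1))
    fun κ W π b h hb _ => polyTime_separationNumber_block h (polyTime_blockSize.lift h) hb
      ((polyTime_n.lift h).add (.const 1)) (fun q => (blockSize_spec _).1) fun q =>
        (blockSize_pow_le _).trans (max_le (Nat.le_add_left ..) (Nat.le_add_right ..))

theorem intervalDim_le_separationSum (P : ListedPoset) :
    intervalDim P.carrier ≤ P.separationSum := by
  have : NeZero (numBlocks P.n) := ⟨Nat.succ_ne_zero _⟩
  rw [separationSum, Finset.sum_range]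
  exact intervalDim_le_sum_separationNumber fun x => ⟨⟨P.index x / blockSize P.n,
    Nat.lt_succ_of_le (Nat.div_le_div_right (P.index_lt x).le)⟩, rfl⟩

theorem separationSum_le (P : ListedPoset) :
    P.separationSum ≤ numBlocks P.n * intervalDim P.carrier := by
  rw [separationSum]
  simpa only [Finset.card_range, smul_eq_mul] using Finset.sum_le_card_nsmul
    (Finset.range (numBlocks P.n)) (fun b => separationNumber (P.block (blockSize P.n) b)) _
      fun _ _ => separationNumber_le_intervalDim _

end ListedPoset

theorem ListedPoset.exists_prog : ∃ (p : RAM.Prog) (T : Polynomial ℕ), ∀ P : ListedPoset.{u},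
    ∃ t s, RAM.Exec p (relationInput P.n fun i j => P.enum i ≤ P.enum j) t s ∧ t ≤ T.eval P.n ∧
      s.var 0 = P.separationSum := by
  obtain ⟨p, K, ⟨T, hT⟩, hp⟩ := polyTime_separationSum.computes 1 le_rfl
  refine ⟨.seq p (.assign 0 (.var 1)), T + 2, fun P => ?_⟩
  obtain ⟨t, s, h, hs, -, ht⟩ := hp P _ ⟨by simp only [relationInput, if_true], rfl⟩
  refine ⟨_, _, .seq h (.assign ..), ?_, (RAM.setVar_var_self ..).trans hs⟩
  rw [Polynomial.eval_add, Polynomial.eval_ofNat]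
  exact Nat.add_le_add_right (ht.trans (hT P)) 2

/-! ### The approximation factor -/

theorem numBlocks_mul_le (n : ℕ) : numBlocks n * blockSize n ≤ 2 * max 1 n := by
  have hpos := (blockSize_spec n).1
  have hk : blockSize n ≤ max 1 n :=
    (Nat.le_self_pow (Nat.mul_pos hpos hpos).ne' _).trans (blockSize_pow_le n)
  have hn : n ≤ max 1 n := le_max_right 1 n
  calc numBlocks n * blockSize n = n / blockSize n * blockSize n + blockSize n := Nat.succ_mul ..
    _ ≤ n + max 1 n := Nat.add_le_add (Nat.div_mul_le_self _ _) hk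
    _ ≤ 2 * max 1 n := by omega

theorem log_le_blockSize_succ {n : ℕ} (hn : n ≠ 0) :
    Real.log n ≤ (blockSize n + 1) ^ 2 * Real.log (blockSize n + 1) := by
  have hlt : (n : ℝ) ≤ ((blockSize n : ℝ) + 1) ^ ((blockSize n + 1) * (blockSize n + 1)) := by
    exact_mod_cast (blockSize_spec n).2.le
  have hlog := Real.log_le_log (by positivity) hlt
  rw [Real.log_pow, ← sq] at hlog
  exact_mod_cast hlog

theorem blockSize_succ_le_log_sq {n : ℕ} (hn : 3 ≤ Real.log n) :
    (blockSize n : ℝ) + 1 ≤ Real.log n ^ 2 := by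
  have hn1 : 1 ≤ n := Nat.one_le_iff_ne_zero.2 fun h => by norm_num [h] at hn
  rcases Nat.lt_or_ge (blockSize n) 2 with hk | hk
  · have hk1 : (blockSize n : ℝ) ≤ 1 := by exact_mod_cast Nat.lt_succ_iff.1 hk
    nlinarith
  · have hpow : (2 : ℝ) ^ (blockSize n * blockSize n) ≤ n := by
      exact_mod_cast (Nat.pow_le_pow_left hk _).trans
        ((blockSize_pow_le n).trans_eq (max_eq_right hn1))
    have hlog := Real.log_le_log (by positivity) hpow
    rw [Real.log_pow] at hlog
    push_cast at hlog
    have hk2 : (2 : ℝ) ≤ blockSize n := by exact_mod_cast hk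
    have hlog2 := Real.log_two_gt_d9
    have hk_le : (blockSize n : ℝ) * 1 ≤ blockSize n * (blockSize n * Real.log 2) :=
      mul_le_mul_of_nonneg_left (by nlinarith) (by linarith)
    nlinarith

theorem log_le_blockSize {n : ℕ} (hn : 3 ≤ Real.log n) :
    Real.log n ≤ 8 * (blockSize n : ℝ) ^ 2 * Real.log (Real.log n) := by
  have hk : (1 : ℝ) ≤ blockSize n := by exact_mod_cast (blockSize_spec n).1
  have hloglog : Real.log ((blockSize n : ℝ) + 1) ≤ 2 * Real.log (Real.log n) := by
    simpa only [Real.log_pow, Nat.cast_ofNat] using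
      Real.log_le_log (by positivity) (blockSize_succ_le_log_sq hn)
  calc Real.log n ≤ (blockSize n + 1 : ℝ) ^ 2 * Real.log (blockSize n + 1) :=
        log_le_blockSize_succ fun h => by norm_num [h] at hn
    _ ≤ (2 * (blockSize n : ℝ)) ^ 2 * (2 * Real.log (Real.log n)) := by
        gcongr
        · exact Real.log_nonneg (by linarith)
        · linarith
    _ = 8 * (blockSize n : ℝ) ^ 2 * Real.log (Real.log n) := by ring

theorem numBlocks_isBigO : (fun n => (numBlocks n : ℝ)) =O[Filter.atTop] approxRate := by
  have hlog : ∀ᶠ n : ℕ in Filter.atTop, 3 ≤ Real.log n :=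
    (Real.tendsto_log_atTop.comp tendsto_natCast_atTop_atTop).eventually_ge_atTop 3
  refine Asymptotics.IsBigO.of_bound (2 * √8) ?_
  filter_upwards [hlog, Filter.eventually_ge_atTop 1] with n hL hn
  have hsqrt : √(Real.log n) ≤ √8 * blockSize n * √(Real.log (Real.log n)) := by
    have := Real.sqrt_le_sqrt (log_le_blockSize hL)
    rwa [Real.sqrt_mul (by positivity), Real.sqrt_mul (by positivity),
      Real.sqrt_sq (Nat.cast_nonneg _)] at this
  have hblocks : (numBlocks n : ℝ) * blockSize n ≤ 2 * n := by
    exact_mod_cast (numBlocks_mul_le n).trans_eq (by rw [max_eq_right hn])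
  have hrate : 0 ≤ approxRate n := by unfold approxRate; positivity
  rw [Real.norm_of_nonneg (Nat.cast_nonneg _), Real.norm_of_nonneg hrate, approxRate,
    ← mul_div_assoc, le_div_iff₀ (Real.sqrt_pos.2 (by linarith))]
  calc (numBlocks n : ℝ) * √(Real.log n)
      ≤ numBlocks n * (√8 * blockSize n * √(Real.log (Real.log n))) := by gcongr
    _ = numBlocks n * blockSize n * (√8 * √(Real.log (Real.log n))) := by ring
    _ ≤ 2 * n * (√8 * √(Real.log (Real.log n))) := by gcongr
    _ = 2 * √8 * (n * √(Real.log (Real.log n))) := by ring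

theorem mainTheorem7 :
    ∃ (p : RAM.Prog) (T : Polynomial ℕ) (α : ℕ → ℝ),
      α =O[Filter.atTop] approxRate ∧
      ∀ (n : ℕ), 1 ≤ n → ∀ (X : Type*) [PartialOrder X] (e : Fin n ≃ X),
        ∃ (t : ℕ) (s : RAM.Store),
          RAM.Exec p (relationInput n (fun i j => e i ≤ e j)) t s ∧
          t ≤ T.eval n ∧
          intervalDim X ≤ s.var 0 ∧
          (s.var 0 : ℝ) ≤ α n * (intervalDim X : ℝ) := by
  obtain ⟨p, T, hp⟩ := ListedPoset.exists_prog
  refine ⟨p, T, fun n => numBlocks n, numBlocks_isBigO, fun n _ X _ e => ?_⟩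
  obtain ⟨t, s, hexec, ht, hs⟩ := hp ⟨n, X, e⟩
  refine ⟨t, s, hexec, ht, ?_, ?_⟩
  · exact (ListedPoset.intervalDim_le_separationSum _).trans_eq hs.symm
  · have hle : s.var 0 ≤ numBlocks n * intervalDim X :=
      hs.trans_le (ListedPoset.separationSum_le _)
    beta_reduce
    exact_mod_cast hle
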